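/- Let $\overline M$ be a metric structure (possibly many-sorted) in continuous logic, for instance a monster model of a complete theory, and let $M\subseteq\overline M$ be a set of parameters, for instance a small elementary submodel. For tuples (of any length) $\bar a,\bar a'$ write $\bar a\equiv_M\bar a'$ if they have the same type over $M$. A *predicate* over a parameter set is a uniform limit of formulas with parameters in that set; such a predicate may involve infinitely many variables and parameters. Let $G$ be a group definable over $M$: $G$ is a closed subset of a finite product of sorts of $\overline M$, the function $x\mapsto d(x,G)$ is a predicate over $M$, and there is a predicate $Q$ over $M$ with $Q(g,h,k)=d(gh,k)$ for $g,h,k\in G$. A *predicate on $G$* is the restriction to $G$ of a predicate with parameters in $\overline M$; it is *positive* if it is $\geq 0$ on $G$, and $P\le Q$ means $P(x)\le Q(x)$ for all $x\in G$. A *mean* is a linear functional $\mathfrak m$ on the real vector space of predicates on $G$ with $\mathfrak m(\mathbf 1)=1$ and $\mathfrak m(P)\ge 0$ for every positive $P$. Assume that $G$ is definably amenable, witnessed by an $M$-invariant mean; that is, $\mathfrak m$ is a mean such that * ($G$-invariance) $\mathfrak m(g\cdot P)=\mathfrak m(P)$ for all $g\in G$ and all predicates $P$ on $G$, where $(g\cdot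 P)(x)=P(g^{-1}x)$; * ($M$-invariance) $\mathfrak m(P(x,\bar a))=\mathfrak m(P(x,\bar a'))$ for every predicate $P(x,\bar y)$ over $M$ and all $\bar a\equiv_M\bar a'$. For a predicate $P$ on $G$ put $\overline P=1\dot-(1\dot-P)$, where $s\dot- t=\max(s-t,0)$; so $\overline P=\min(P,1)$ if $P$ is positive. Call a positive predicate $P$ on $G$ *small* if $\lim_{\lambda\to\infty}\mathfrak m(\overline{\lambda P})=1$, and let $I$ be the set of small positive predicates on $G$. Then: 1. $I$ is an ideal: if $P\in I$ and $Q\ge P$ is a predicate on $G$, then $Q\in I$; if $P,Q\in I$, then $PQ\in I$; and every constant $\lambda>0$ belongs to $I$. 2. $I$ is $M$-invariant: if $P(x,\bar y)$ is a predicate over $M$, $P(x,\bar a)\in I$ and $\bar a\equiv_M\bar a'$, then $P(x,\bar a')\in I$. 3. $I$ is $S_1$ over $M$: let $(P_i)_{i<\omega}$ be an $M$-indiscernible sequence of positive predicates on $G$, i.e. $P_i=P(x,\bar a_i)$ for a predicate $P(x,\bar y)$ over $M$ and an $M$-indiscernible sequence $(\bar a_i)_{i<\omega}$ of tuples. If $P_i+P_j\in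 I$ for all $i\neq j$, then $P_i\in I$ for every $i$. -/

import Mathlib

open Filter Topology

namespace ContLogic

universe uS uF uR uN w w'

/-- A many-sorted language of continuous logic: sorts with a bound for their metric, function
symbols and bounded real-valued relation symbols, with one modulus of uniform continuity for each
argument place. -/
structure Language where
  Sorts : Type uS
  bound : Sorts → ℝ
  bound_pos : ∀ S, 0 < bound S
  Func : Type uF
  funcArity : Func → ℕ
  funcDom : ∀ f, Fin (funcArity f) → Sorts
  funcRng : Func → Sorts
  funcMod : ∀ f, Fin (funcArity f) → ℝ → ℝ
  funcMod_pos : ∀ f i ε, 0 < ε → 0 < funcMod f i ε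
  Rel : Type uR
  relArity : Rel → ℕ
  relDom : ∀ R, Fin (relArity R) → Sorts
  relLo : Rel → ℝ
  relHi : Rel → ℝ
  relMod : ∀ R, Fin (relArity R) → ℝ → ℝ
  relMod_pos : ∀ R i ε, 0 < ε → 0 < relMod R i ε

/-- Terms of sort `S` whose variables are indexed by `α`, the variable `i` being of sort `s i`. -/
inductive Term (L : Language.{uS, uF, uR}) {α : Type w} (s : α → L.Sorts) :
    L.Sorts → Type (max uS uF w)
  | var (i : α) : Term L s (s i)
  | func (f : L.Func) (t : ∀ i, Term L s (L.funcDom f i)) : Term L s (L.funcRng f)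

/-- The sorts of the variables after one new variable `none` of sort `S` has been added. -/
def consSort {L : Language.{uS, uF, uR}} {α : Type w} (S : L.Sorts) (s : α → L.Sorts) :
    Option α → L.Sorts
  | none => S
  | some i => s i

/-- Formulas with free variables indexed by `α`, the variable `i` being of sort `s i`.  The
connectives are all uniformly continuous functions `ℝⁿ → ℝ`; the quantifiers `inf`, `sup` bind the
variable `none`. -/
inductive Formula (L : Language.{uS, uF, uR}) :
    (α : Type w) → (α → L.Sorts) → Type (max uS uF uR (w + 1))
  | dist {α : Type w} {s : α → L.Sorts} (S : L.Sorts) (t₁ t₂ : Term L s S) : Formula L α s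
  | rel {α : Type w} {s : α → L.Sorts} (R : L.Rel) (t : ∀ i, Term L s (L.relDom R i)) :
      Formula L α s
  | conn {α : Type w} {s : α → L.Sorts} (n : ℕ) (f : (Fin n → ℝ) → ℝ)
      (hf : UniformContinuous f) (φ : Fin n → Formula L α s) : Formula L α s
  | inf {α : Type w} {s : α → L.Sorts} (S : L.Sorts)
      (φ : Formula L (Option α) (consSort S s)) : Formula L α s
  | sup {α : Type w} {s : α → L.Sorts} (S : L.Sorts)
      (φ : Formula L (Option α) (consSort S s)) : Formula L α s

/-- Metric structures.  A symbol with modulus `δ` at the `i`-th place moves by at most `ε` when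
the `i`-th argument alone moves by less than `δ ε`. -/
structure Struc (L : Language.{uS, uF, uR}) where
  carrier : L.Sorts → Type uN
  metric : ∀ S, MetricSpace (carrier S)
  nonempty : ∀ S, Nonempty (carrier S)
  dist_le : ∀ S (a b : carrier S), dist a b ≤ L.bound S
  func : ∀ f, (∀ i, carrier (L.funcDom f i)) → carrier (L.funcRng f)
  func_cont : ∀ f i ε, 0 < ε → ∀ a b : ∀ i, carrier (L.funcDom f i),
    (∀ j, j ≠ i → a j = b j) → dist (a i) (b i) < L.funcMod f i ε → dist (func f a) (func f b) ≤ ε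
  rel : ∀ R, (∀ i, carrier (L.relDom R i)) → ℝ
  rel_mem : ∀ R a, rel R a ∈ Set.Icc (L.relLo R) (L.relHi R)
  rel_cont : ∀ R i ε, 0 < ε → ∀ a b : ∀ i, carrier (L.relDom R i),
    (∀ j, j ≠ i → a j = b j) → dist (a i) (b i) < L.relMod R i ε → |rel R a - rel R b| ≤ ε

attribute [instance] Struc.metric Struc.nonempty

variable {L : Language.{uS, uF, uR}}

/-- Tuples of elements of `N`, of sorts `s`.  For finitely many coordinates they carry the
maximum metric. -/
abbrev Tuple (N : Struc.{uS, uF, uR, uN} L) {α : Type w} (s : α → L.Sorts) : Type (max w uN) :=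
  ∀ i, N.carrier (s i)

section Semantics

variable {N : Struc.{uS, uF, uR, uN} L} {α : Type w} {β : Type w'}

/-- Add the value `x` of the new variable `none`. -/
def Tuple.cons {s : α → L.Sorts} {S : L.Sorts} (x : N.carrier S) (v : Tuple N s) :
    Tuple N (consSort S s)
  | none => x
  | some i => v i

/-- Concatenation of tuples. -/
def Tuple.append {s : α → L.Sorts} {t : β → L.Sorts} (v : Tuple N s) (a : Tuple N t) :
    Tuple N (Sum.elim s t)
  | Sum.inl i => v i
  | Sum.inr j => a j

/-- The value of a term. -/
def Term.eval {s : α → L.Sorts} (v : Tuple N s) : {S : L.Sorts} → Term L s S → N.carrier S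
  | _, .var i => v i
  | _, .func f t => N.func f fun i => (t i).eval v

/-- The value of a formula. -/
noncomputable def Formula.eval : {α : Type w} → {s : α → L.Sorts} →
    Formula L α s → Tuple N s → ℝ
  | _, _, .dist _ t₁ t₂, v => Dist.dist (t₁.eval v) (t₂.eval v)
  | _, _, .rel R t, v => N.rel R fun i => (t i).eval v
  | _, _, .conn _ f _ φ, v => f fun i => (φ i).eval v
  | _, _, .inf _ φ, v => ⨅ x, φ.eval (Tuple.cons x v)
  | _, _, .sup _ φ, v => ⨆ x, φ.eval (Tuple.cons x v)

end Semantics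

/-- Sets of parameters in `N`. -/
abbrev Params (N : Struc.{uS, uF, uR, uN} L) := ∀ S, Set (N.carrier S)

section Parameters

variable {N : Struc.{uS, uF, uR, uN} L} (A : Params N) {α : Type w}

/-- Names for the elements of `A`. -/
abbrev Names : Type (max uS uN) := Σ S, A S

/-- The formulas of `L(A)` with free variables of sorts `s`: the elements of `A` are added as
further symbols, which always stand for themselves. -/
abbrev FormulaOver (s : α → L.Sorts) :=
  Formula L (α ⊕ Names A) (Sum.elim s (Sigma.fst : Names A → L.Sorts))

/-- The value of a formula of `L(A)`. -/
noncomputable def FormulaOver.val {A : Params N} {s : α → L.Sorts} (φ : FormulaOver A s)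
    (v : Tuple N s) : ℝ :=
  Formula.eval (N := N) φ
    (Tuple.append v (t := (Sigma.fst : Names A → L.Sorts)) fun c => (c.2 : N.carrier c.1))

/-- Definable predicates over `A`: uniform limits of formulas of `L(A)`.  The free variables may
be infinitely many; each formula uses finitely many of them. -/
def IsPredicate {s : α → L.Sorts} (P : Tuple N s → ℝ) : Prop :=
  ∀ ε > 0, ∃ φ : FormulaOver A s, ∀ v, |φ.val v - P v| ≤ ε

/-- `a ≡_A a'`: the two tuples have the same type over `A`. -/
def TypeEq {s : α → L.Sorts} (a a' : Tuple N s) : Prop :=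
  ∀ φ : FormulaOver A s, φ.val a = φ.val a'

/-- `A`-indiscernible sequences of tuples. -/
def Indiscernible {s : α → L.Sorts} (a : ℕ → Tuple N s) : Prop :=
  ∀ (k : ℕ) (i j : Fin k → ℕ), StrictMono i → StrictMono j →
    TypeEq A (s := fun p : Fin k × α => s p.2)
      (fun p => a (i p.1) p.2) (fun p => a (j p.1) p.2)

variable {A}

/-- Predicates are closed under uniformly continuous connectives. -/
theorem IsPredicate.conn {s : α → L.Sorts} {n : ℕ} {f : (Fin n → ℝ) → ℝ}
    (hf : UniformContinuous f) {P : Fin n → Tuple N s → ℝ} (hP : ∀ i, IsPredicate A (P i)) :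
    IsPredicate A fun v => f fun i => P i v := by
  intro ε hε
  obtain ⟨δ, hδ, h⟩ := Metric.uniformContinuous_iff.1 hf ε hε
  choose φ hφ using fun i => hP i (δ / 2) (half_pos hδ)
  refine ⟨Formula.conn n f hf φ, fun v => ?_⟩
  have h1 : dist (fun i => (φ i).val v) (fun i => P i v) < δ := by
    refine lt_of_le_of_lt ((dist_pi_le_iff (half_pos hδ).le).2 fun i => ?_) (half_lt_self hδ)
    rw [Real.dist_eq]
    exact hφ i v
  have h2 := (h h1).le
  rw [Real.dist_eq] at h2
  exact h2

theorem IsPredicate.comp {s : α → L.Sorts} {f : ℝ → ℝ} (hf : UniformContinuous f)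
    {P : Tuple N s → ℝ} (hP : IsPredicate A P) : IsPredicate A fun v => f (P v) :=
  IsPredicate.conn (n := 1) (f := fun x => f (x 0))
    (hf.comp (Pi.uniformContinuous_proj (fun _ : Fin 1 => ℝ) 0)) (P := fun _ => P) fun _ => hP

theorem IsPredicate.add {s : α → L.Sorts} {P Q : Tuple N s → ℝ} (hP : IsPredicate A P)
    (hQ : IsPredicate A Q) : IsPredicate A (P + Q) := by
  have h := IsPredicate.conn (A := A) (n := 2) (f := fun x : Fin 2 → ℝ => x 0 + x 1)
    ((Pi.uniformContinuous_proj (fun _ : Fin 2 => ℝ) 0).add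
      (Pi.uniformContinuous_proj (fun _ : Fin 2 => ℝ) 1)) (P := ![P, Q])
    (by intro i; fin_cases i <;> assumption)
  exact h

theorem IsPredicate.const {s : α → L.Sorts} (r : ℝ) :
    IsPredicate A fun _ : Tuple N s => r :=
  IsPredicate.conn (n := 0) (f := fun _ => r) uniformContinuous_const
    (P := fun i => i.elim0) fun i => i.elim0

end Parameters

/-- Groups definable over `A`: the universe is a closed set of finite tuples whose distance
function is a predicate over `A`, and there is a predicate `Q` over `A` with
`Q (g, h, k) = d (g * h, k)` on the group. -/
structure DefGroup (N : Struc.{uS, uF, uR, uN} L) (A : Params N) where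
  n : ℕ
  sorts : Fin n → L.Sorts
  carrier : Set (Tuple N sorts)
  isClosed : IsClosed carrier
  definable : IsPredicate A fun x => Metric.infDist x carrier
  group : Group carrier
  mul_definable : ∃ Q : Tuple N (Sum.elim (Sum.elim sorts sorts) sorts) → ℝ,
    IsPredicate A Q ∧ ∀ g h k : carrier,
      Q (Tuple.append (Tuple.append (g : Tuple N sorts) (h : Tuple N sorts)) (k : Tuple N sorts)) =
        dist (g * h) k

attribute [instance] DefGroup.group

section Group

variable {N : Struc.{uS, uF, uR, uN} L} {A : Params N}

/-- The vector space of predicates on `G` with parameters in the whole structure `N`: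
restrictions to `G` of predicates. -/
def DefGroup.Pred (G : DefGroup N A) : Submodule ℝ (G.carrier → ℝ) where
  carrier := {p | ∃ P : Tuple N G.sorts → ℝ,
    IsPredicate (fun _ => Set.univ) P ∧ ∀ x : G.carrier, p x = P x}
  add_mem' := by
    rintro p q ⟨P, hP, hp⟩ ⟨Q, hQ, hq⟩
    exact ⟨P + Q, hP.add hQ, fun x => by simp [hp, hq]⟩
  zero_mem' := ⟨fun _ => 0, IsPredicate.const 0, fun _ => rfl⟩
  smul_mem' := by
    rintro c p ⟨P, hP, hp⟩
    exact ⟨fun v => c * P v, hP.comp (uniformContinuous_const_smul c), fun x => by simp [hp]⟩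

/-- `1 ∸ (1 ∸ t)`, where `∸` is subtraction truncated at `0`. -/
noncomputable def trunc (t : ℝ) : ℝ := max (1 - max (1 - t) 0) 0

theorem uniformContinuous_trunc : UniformContinuous trunc := by
  have h : LipschitzWith 1 trunc := by
    refine LipschitzWith.of_dist_le_mul fun x y => ?_
    simp only [trunc, Real.dist_eq, NNReal.coe_one, one_mul]
    refine (abs_max_sub_max_le_abs _ _ _).trans ?_
    rw [show 1 - max (1 - x) 0 - (1 - max (1 - y) 0) = max (1 - y) 0 - max (1 - x) 0 by ring]
    refine (abs_max_sub_max_le_abs _ _ _).trans ?_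
    rw [show 1 - y - (1 - x) = x - y by ring]
  exact h.uniformContinuous

/-- The constant predicates on `G`. -/
def DefGroup.constPred (G : DefGroup N A) (r : ℝ) : G.Pred :=
  ⟨fun _ => r, fun _ => r, IsPredicate.const r, fun _ => rfl⟩

/-- The predicate `1 ∸ (1 ∸ p)`. -/
noncomputable def DefGroup.bar (G : DefGroup N A) (p : G.Pred) : G.Pred :=
  ⟨fun x => trunc (p.1 x), by
    obtain ⟨P, hP, hp⟩ := p.2
    exact ⟨fun v => trunc (P v), hP.comp uniformContinuous_trunc, fun x => congrArg trunc (hp x)⟩⟩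

/-- Positive linear functionals on the predicates on `G`, normalized by `m 1 = 1`. -/
structure IsMean (G : DefGroup N A) (m : G.Pred →ₗ[ℝ] ℝ) : Prop where
  nonneg : ∀ p : G.Pred, (∀ x, 0 ≤ p.1 x) → 0 ≤ m p
  one : m (G.constPred 1) = 1

/-- Invariance under the left translations `(g • p) x = p (g⁻¹ * x)`. -/
def IsGInvariant (G : DefGroup N A) (m : G.Pred →ₗ[ℝ] ℝ) : Prop :=
  ∀ (g : G.carrier) (p q : G.Pred), (∀ x, q.1 x = p.1 (g⁻¹ * x)) → m q = m p

/-- The restriction to `G` of the instance `P (x, a)` of `P (x, y)`. -/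
def DefGroup.inst (G : DefGroup N A) {β : Type w} {t : β → L.Sorts}
    (P : Tuple N (Sum.elim G.sorts t) → ℝ) (a : Tuple N t) : G.carrier → ℝ :=
  fun x => P (Tuple.append (x : Tuple N G.sorts) a)

/-- `A`-invariance: `m (P (x, a)) = m (P (x, a'))` whenever `P (x, y)` is a predicate over `A` and
`a ≡_A a'`.  Here `y` is a tuple of any length, as a predicate may depend on infinitely many
parameters. -/
def IsInvariantMean (G : DefGroup N A) (m : G.Pred →ₗ[ℝ] ℝ) : Prop :=
  ∀ (β : Type) (t : β → L.Sorts) (P : Tuple N (Sum.elim G.sorts t) → ℝ), IsPredicate A P →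
    ∀ a a' : Tuple N t, TypeEq A a a' →
      ∀ p p' : G.Pred, p.1 = G.inst P a → p'.1 = G.inst P a' → m p = m p'

/-- Positive predicates on `G`. -/
def DefGroup.Positive (G : DefGroup N A) : Set (G.carrier → ℝ) :=
  {p | p ∈ G.Pred ∧ ∀ x, 0 ≤ p x}

/-- The small positive predicates with respect to `m`. -/
def small (G : DefGroup N A) (m : G.Pred →ₗ[ℝ] ℝ) : Set (G.carrier → ℝ) :=
  {p | (∀ x, 0 ≤ p x) ∧ ∃ h : p ∈ G.Pred,
    Tendsto (fun r : ℝ => m (G.bar (r • (⟨p, h⟩ : G.Pred)))) atTop (𝓝 1)}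

/-- Ideals of positive predicates. -/
structure IsIdeal (G : DefGroup N A) (I : Set (G.carrier → ℝ)) : Prop where
  subset : I ⊆ G.Positive
  upward : ∀ p ∈ I, ∀ q ∈ G.Positive, (∀ x, p x ≤ q x) → q ∈ I
  mul : ∀ p ∈ I, ∀ q ∈ I, p * q ∈ I
  const : ∀ r : ℝ, 0 < r → (fun _ => r) ∈ I

/-- `A`-invariance of a set of predicates on `G`. -/
def IsInvariantSet (G : DefGroup N A) (I : Set (G.carrier → ℝ)) : Prop :=
  ∀ (β : Type) (t : β → L.Sorts) (P : Tuple N (Sum.elim G.sorts t) → ℝ), IsPredicate A P →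
    ∀ a a' : Tuple N t, TypeEq A a a' → G.inst P a ∈ I → G.inst P a' ∈ I

/-- `A`-indiscernible sequences of predicates on `G`: those of the form `P (x, a i)`, for a
predicate `P (x, y)` over `A` and an `A`-indiscernible sequence `a`. -/
def IsIndiscernibleSeq (G : DefGroup N A) (p : ℕ → G.carrier → ℝ) : Prop :=
  ∃ (β : Type) (t : β → L.Sorts) (P : Tuple N (Sum.elim G.sorts t) → ℝ) (a : ℕ → Tuple N t),
    IsPredicate A P ∧ Indiscernible A a ∧ ∀ i, p i = G.inst P (a i)

/-- The `S₁` property over `A`. -/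
def IsS1 (G : DefGroup N A) (I : Set (G.carrier → ℝ)) : Prop :=
  ∀ p : ℕ → G.carrier → ℝ, IsIndiscernibleSeq G p → (∀ i, p i ∈ G.Positive) →
    (∀ i j, i ≠ j → p i + p j ∈ I) → ∀ i, p i ∈ I

end Group

end ContLogic

/-!
Let `m` be a mean on the predicates on `G`, and let `bar (r • p)` be the truncation at `1` of the
multiple `r • p` of a positive predicate `p`.  The means of these truncations increase with `r` and
are at most `1`, so `p` is small exactly when they come arbitrarily close to `1`
(`IsMean.tendsto_bar_iff`).

*Ideal* (`isIdeal_small`).  Upward closure is monotonicity of `m`.  For products,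
`bar (r • p) + bar (s • q) ≤ bar ((r * s) • (p * q)) + 1`, by `a + b ≤ a * b + 1` on the unit
interval.  That a product of predicates is a predicate rests on boundedness
(`IsPredicate.exists_bound`): multiplication is a uniformly continuous connective only on bounded
sets.

*Invariance* (`isInvariantSet_small`).  The means of the truncations of `P (x, a)` depend only on
the type of `a`, as `m` is invariant.  Positivity of `P (x, a)` on `G` does too, and this is where
definability of `G` enters (`DefGroup.inst_nonneg_of_typeEq`): by uniform continuity it amounts to
lower bounds on `P (x, a) + K * d (x, G)` over all tuples `x` of the ambient sorts, and these are
conditions on the type of `a`, since the infimum over a finite block of variables is again given by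
a formula (`Formula.exists_inf_block`).

*The `S₁` property* (`isS1_small`).  This is the measure-theoretic fact that infinitely many sets
of the same positive measure cannot be pairwise almost disjoint.  The role of the sets is played by
the functions `q i = 1 - bar (r • p i)` with `r` large, and inclusion-exclusion is replaced by
`∑ i < n, q i ≤ 1 + ∑ i < j < n, min (q i) (q j)` (`sum_le_one_add_sum_min`).  The means of
`bar (r • p i)` do not depend on `i`, as the terms of an indiscernible sequence have the same type.
-/

namespace ContLogic

universe uS uF uR uN w w'

variable {L : Language.{uS, uF, uR}}

/-! ### Substitution of terms for variables -/

section Substitution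

/-- Simultaneous substitution of the terms `σ i` for the variables of a term. -/
def Term.subst {α : Type w} {β : Type w'} {s : α → L.Sorts} {t : β → L.Sorts}
    (σ : ∀ i, Term L t (s i)) : {S : L.Sorts} → Term L s S → Term L t S
  | _, .var i => σ i
  | _, .func f u => .func f fun i => (u i).subst σ

/-- A substitution extended to one further variable `none`, which it fixes. -/
def substLift {α : Type w} {β : Type w'} {s : α → L.Sorts} {t : β → L.Sorts} (S : L.Sorts)
    (σ : ∀ i, Term L t (s i)) : ∀ i, Term L (consSort S t) (consSort S s i)
  | none => .var (s := consSort S t) none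
  | some i => (σ i).subst fun j => .var (s := consSort S t) (some j)

/-- Simultaneous substitution of the terms `σ i` for the free variables of a formula.  It is
capture-free, as the bound variable of a quantifier is the new element of an `Option` type. -/
def Formula.subst : {α : Type w} → {s : α → L.Sorts} → Formula L α s →
    {β : Type w} → {t : β → L.Sorts} → (∀ i, Term L t (s i)) → Formula L β t
  | _, _, .dist S t₁ t₂, _, _, σ => .dist S (t₁.subst σ) (t₂.subst σ)
  | _, _, .rel R u, _, _, σ => .rel R fun i => (u i).subst σ
  | _, _, .conn n f hf φ, _, _, σ => .conn n f hf fun i => (φ i).subst σ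
  | _, _, .inf S φ, _, _, σ => .inf S (φ.subst (substLift S σ))
  | _, _, .sup S φ, _, _, σ => .sup S (φ.subst (substLift S σ))

variable {N : Struc.{uS, uF, uR, uN} L}

theorem Term.eval_subst {α : Type w} {β : Type w'} {s : α → L.Sorts} {t : β → L.Sorts}
    (σ : ∀ i, Term L t (s i)) (v : Tuple N t) {S : L.Sorts} (u : Term L s S) :
    (u.subst σ).eval v = u.eval (N := N) fun i => (σ i).eval v := by
  induction u with
  | var i => rfl
  | func f u ih => simp only [Term.subst, Term.eval, ih]

theorem eval_substLift {α : Type w} {β : Type w'} {s : α → L.Sorts} {t : β → L.Sorts}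
    {S : L.Sorts} (σ : ∀ i, Term L t (s i)) (x : N.carrier S) (v : Tuple N t) :
    (fun i => (substLift S σ i).eval (Tuple.cons x v)) =
      Tuple.cons (s := s) x fun i => (σ i).eval v := by
  funext i
  cases i with
  | none => rfl
  | some i => exact Term.eval_subst _ _ _

theorem Formula.eval_subst {α : Type w} {s : α → L.Sorts} (φ : Formula L α s) :
    ∀ {β : Type w} {t : β → L.Sorts} (σ : ∀ i, Term L t (s i)) (v : Tuple N t),
      (φ.subst σ).eval v = φ.eval (N := N) fun i => (σ i).eval v := by
  induction φ with
  | dist S t₁ t₂ => intros; simp only [Formula.subst, Formula.eval, Term.eval_subst]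
  | rel R u => intros; simp only [Formula.subst, Formula.eval, Term.eval_subst]
  | conn n f hf φ ih => intros; simp only [Formula.subst, Formula.eval, ih]
  | inf S φ ih => intros; simp only [Formula.subst, Formula.eval, ih, eval_substLift]
  | sup S φ ih => intros; simp only [Formula.subst, Formula.eval, ih, eval_substLift]

/-- Predicates are closed under substitution of terms that may use the parameters of a further
set `B`.  This covers adding dummy variables, reindexing variables, and plugging in parameters. -/
theorem IsPredicate.subst {A B : Params N} (hAB : ∀ S, A S ⊆ B S) {α β : Type w}
    {s : α → L.Sorts} {t : β → L.Sorts}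
    (σ : ∀ i, Term L (Sum.elim t (Sigma.fst : Names B → L.Sorts)) (s i)) {P : Tuple N s → ℝ}
    (hP : IsPredicate A P) :
    IsPredicate B fun v : Tuple N t => P fun i => (σ i).eval (N := N)
      (Tuple.append v (t := (Sigma.fst : Names B → L.Sorts)) fun c => (c.2 : N.carrier c.1)) := by
  intro ε hε
  obtain ⟨φ, hφ⟩ := hP ε hε
  -- The names of elements of `A` become names of the same elements of `B`.
  let τ : ∀ i : α ⊕ Names A, Term L (Sum.elim t (Sigma.fst : Names B → L.Sorts))
      (Sum.elim s (Sigma.fst : Names A → L.Sorts) i) := fun i => match i with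
    | .inl i => σ i
    | .inr c => .var (s := Sum.elim t (Sigma.fst : Names B → L.Sorts))
        (.inr ⟨c.1, c.2.1, hAB _ c.2.2⟩)
  refine ⟨Formula.subst φ τ, fun v => ?_⟩
  convert hφ _ using 3
  refine (Formula.eval_subst _ _ _).trans ?_
  unfold FormulaOver.val
  congr 1
  funext i
  cases i <;> rfl

theorem isPredicate_val {A : Params N} {α : Type w} {s : α → L.Sorts} (φ : FormulaOver A s) :
    IsPredicate A fun v : Tuple N s => φ.val v :=
  fun ε hε => ⟨φ, fun v => by simpa using hε.le⟩

theorem TypeEq.eq_of_isPredicate {A : Params N} {α : Type w} {s : α → L.Sorts}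
    {a a' : Tuple N s} (h : TypeEq A a a') {P : Tuple N s → ℝ} (hP : IsPredicate A P) :
    P a = P a' := by
  refine eq_of_forall_dist_le fun ε hε => ?_
  obtain ⟨φ, hφ⟩ := hP (ε / 2) (half_pos hε)
  have h1 := abs_le.1 (hφ a)
  have h2 := abs_le.1 (hφ a')
  rw [h φ] at h1
  rw [Real.dist_eq, abs_le]
  constructor <;> linarith

/-- Any two terms of an indiscernible sequence have the same type. -/
theorem Indiscernible.typeEq {A : Params N} {α : Type w} {s : α → L.Sorts} {a : ℕ → Tuple N s}
    (ha : Indiscernible A a) (i j : ℕ) : TypeEq A (a i) (a j) := by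
  intro φ
  have h := ha 1 (fun _ => i) (fun _ => j) (Subsingleton.strictMono _) (Subsingleton.strictMono _)
  exact h.eq_of_isPredicate ((isPredicate_val φ).subst (fun _ => subset_rfl)
    (t := fun p : Fin 1 × α => s p.2)
    fun i => .var (s := Sum.elim (fun p : Fin 1 × α => s p.2) (Sigma.fst : Names A → L.Sorts))
      (.inl (0, i)))

end Substitution

/-! ### Boundedness and uniform continuity of predicates -/

section Continuity

variable {N : Struc.{uS, uF, uR, uN} L}

theorem Formula.exists_bound {α : Type w} {s : α → L.Sorts} (φ : Formula L α s) :
    ∃ B, ∀ v : Tuple N s, |φ.eval v| ≤ B := by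
  induction φ with
  | dist S t₁ t₂ =>
    exact ⟨L.bound S, fun v => by
      simpa only [Formula.eval, abs_of_nonneg dist_nonneg] using N.dist_le S _ _⟩
  | rel R u =>
    exact ⟨max |L.relLo R| |L.relHi R|, fun v =>
      abs_le_max_abs_abs (N.rel_mem R _).1 (N.rel_mem R _).2⟩
  | conn n f hf φ ih =>
    choose B hB using ih
    -- The values of the subformulas stay in a compact box, on which the connective is bounded.
    have hK : IsCompact (Set.univ.pi fun i => Set.Icc (-B i) (B i)) :=
      isCompact_univ_pi fun i => isCompact_Icc
    obtain ⟨C, hC⟩ := hK.exists_bound_of_continuousOn hf.continuous.continuousOn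
    exact ⟨C, fun v => hC _ fun i _ => abs_le.1 (hB i v)⟩
  | inf S φ ih =>
    obtain ⟨B, hB⟩ := ih
    refine ⟨B, fun v => abs_le.2 ⟨le_ciInf fun x => (abs_le.1 (hB _)).1, ?_⟩⟩
    obtain ⟨x⟩ := N.nonempty S
    exact (ciInf_le ⟨-B, by rintro _ ⟨y, rfl⟩; exact (abs_le.1 (hB _)).1⟩ x).trans
      (abs_le.1 (hB _)).2
  | sup S φ ih =>
    obtain ⟨B, hB⟩ := ih
    refine ⟨B, fun v => abs_le.2 ⟨?_, ciSup_le fun x => (abs_le.1 (hB _)).2⟩⟩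
    obtain ⟨x⟩ := N.nonempty S
    exact (abs_le.1 (hB _)).1.trans
      (le_ciSup (f := fun x => φ.eval (Tuple.cons x v))
        ⟨B, by rintro _ ⟨y, rfl⟩; exact (abs_le.1 (hB _)).2⟩ x)

theorem IsPredicate.exists_bound {A : Params N} {α : Type w} {s : α → L.Sorts}
    {P : Tuple N s → ℝ} (hP : IsPredicate A P) : ∃ B, ∀ v, |P v| ≤ B := by
  obtain ⟨φ, hφ⟩ := hP 1 one_pos
  obtain ⟨B, hB⟩ := Formula.exists_bound (N := N) φ
  refine ⟨B + 1, fun v => ?_⟩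
  have h1 := abs_le.1 (hφ v)
  have h2 : -B ≤ φ.val v ∧ φ.val v ≤ B := abs_le.1 (hB _)
  exact abs_le.2 ⟨by linarith [h2.1], by linarith [h2.2]⟩

theorem exists_pos_forall_le {ι : Type*} [Finite ι] (f : ι → ℝ) (hf : ∀ i, 0 < f i) :
    ∃ δ > 0, ∀ i, δ ≤ f i := by
  cases nonempty_fintype ι
  obtain hι | hι := isEmpty_or_nonempty ι
  · exact ⟨1, one_pos, fun i => isEmptyElim i⟩
  · obtain ⟨i, hi⟩ := Finite.exists_min f
    exact ⟨f i, hf i, hi⟩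

/-- A function of finitely many arguments with a modulus of uniform continuity in each argument
separately is uniformly continuous: the arguments are changed one at a time. -/
theorem exists_joint_modulus {n : ℕ} {X : Fin n → Type*} [∀ i, MetricSpace (X i)] {Y : Type*}
    [PseudoMetricSpace Y] (F : (∀ i, X i) → Y) (μ : Fin n → ℝ → ℝ)
    (hμ : ∀ i ε, 0 < ε → 0 < μ i ε)
    (hF : ∀ i ε, 0 < ε → ∀ a b : ∀ i, X i, (∀ j, j ≠ i → a j = b j) →
      dist (a i) (b i) < μ i ε → dist (F a) (F b) ≤ ε) {ε : ℝ} (hε : 0 < ε) :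
    ∃ δ > 0, ∀ a b : ∀ i, X i, (∀ i, dist (a i) (b i) < δ) → dist (F a) (F b) < ε := by
  classical
  have hη : 0 < ε / (n + 1) := by positivity
  obtain ⟨δ, hδ, hle⟩ := exists_pos_forall_le _ fun i => hμ i _ hη
  refine ⟨δ, hδ, fun a b hab => ?_⟩
  have key : ∀ (T : Finset (Fin n)) (a : ∀ i, X i), (∀ i ∉ T, a i = b i) →
      (∀ i, dist (a i) (b i) < δ) → dist (F a) (F b) ≤ T.card * (ε / (n + 1)) := by
    intro T
    induction T using Finset.induction_on with
    | empty =>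
      intro a h _
      have : a = b := funext fun i => h i (Finset.notMem_empty i)
      simp [this]
    | insert i T hi ih =>
      intro a h hd
      have h1 : dist (F a) (F (Function.update a i (b i))) ≤ ε / (n + 1) :=
        hF i _ hη _ _ (fun j hj => by simp [hj]) (by simpa using (hd i).trans_le (hle i))
      have h2 := ih (Function.update a i (b i))
        (fun j hj => by
          by_cases hji : j = i
          · subst hji; simp
          · simpa [hji] using h j (by simp [hji, hj]))
        (fun j => by
          by_cases hji : j = i
          · subst hji; simpa using hδ
          · simpa [hji] using hd j)
      rw [Finset.card_insert_of_notMem hi]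
      push_cast
      linarith [dist_triangle (F a) (F (Function.update a i (b i))) (F b)]
  refine (key Finset.univ a (fun i hi => absurd (Finset.mem_univ i) hi) hab).trans_lt ?_
  rw [Finset.card_univ, Fintype.card_fin, mul_div_assoc', div_lt_iff₀ (by positivity)]
  nlinarith

theorem Term.exists_modulus {α : Type w} {s : α → L.Sorts} {S : L.Sorts} (u : Term L s S) :
    ∀ ε > 0, ∃ δ > 0, ∀ v v' : Tuple N s, (∀ i, dist (v i) (v' i) < δ) →
      dist (u.eval v) (u.eval v') < ε := by
  induction u with
  | var i => exact fun ε hε => ⟨ε, hε, fun v v' h => h i⟩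
  | func f u ih =>
    intro ε hε
    obtain ⟨η, hη, hf⟩ := exists_joint_modulus (N.func f) _ (L.funcMod_pos f) (N.func_cont f) hε
    choose δ hδ h using fun i => ih i η hη
    obtain ⟨δ', hδ', hle⟩ := exists_pos_forall_le δ hδ
    exact ⟨δ', hδ', fun v v' hv => hf _ _ fun i => h i v v' fun j => (hv j).trans_le (hle i)⟩

/-- A formula is uniformly continuous in all its variables together.  As only finitely many
variables occur, one `δ` serves them all. -/
theorem Formula.exists_modulus {α : Type w} {s : α → L.Sorts} (φ : Formula L α s) :
    ∀ ε > 0, ∃ δ > 0, ∀ v v' : Tuple N s, (∀ i, Dist.dist (v i) (v' i) < δ) →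
      |φ.eval v - φ.eval v'| ≤ ε := by
  have bdd (α : Type w) (s : α → L.Sorts) (S : L.Sorts) (φ : Formula L (Option α) (consSort S s))
      (v : Tuple N s) : BddBelow (Set.range fun x => φ.eval (Tuple.cons x v)) ∧
        BddAbove (Set.range fun x => φ.eval (Tuple.cons x v)) := by
    obtain ⟨B, hB⟩ := φ.exists_bound (N := N)
    exact ⟨⟨-B, by rintro _ ⟨x, rfl⟩; exact (abs_le.1 (hB _)).1⟩,
      ⟨B, by rintro _ ⟨x, rfl⟩; exact (abs_le.1 (hB _)).2⟩⟩
  have cons_lt {α : Type w} {s : α → L.Sorts} {S : L.Sorts} {δ : ℝ} (hδ : 0 < δ)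
      {v v' : Tuple N s} (h : ∀ i, Dist.dist (v i) (v' i) < δ) (x : N.carrier S) (i : Option α) :
      Dist.dist (Tuple.cons x v i) (Tuple.cons x v' i) < δ := by
    cases i with
    | none => exact (dist_self x).trans_lt hδ
    | some i => exact h i
  induction φ with
  | dist S t₁ t₂ =>
    intro ε hε
    obtain ⟨δ₁, h₁, H₁⟩ := t₁.exists_modulus (N := N) (ε / 2) (half_pos hε)
    obtain ⟨δ₂, h₂, H₂⟩ := t₂.exists_modulus (N := N) (ε / 2) (half_pos hε)
    refine ⟨min δ₁ δ₂, lt_min h₁ h₂, fun v v' h => ?_⟩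
    have e₁ := H₁ v v' fun i => (h i).trans_le (min_le_left _ _)
    have e₂ := H₂ v v' fun i => (h i).trans_le (min_le_right _ _)
    have := dist_dist_dist_le (t₁.eval v) (t₂.eval v) (t₁.eval v') (t₂.eval v')
    rw [Real.dist_eq] at this
    simp only [Formula.eval]
    linarith
  | rel R u =>
    intro ε hε
    obtain ⟨η, hη, hR⟩ := exists_joint_modulus (N.rel R) _ (L.relMod_pos R)
      (fun i ε hε a b h => by rw [Real.dist_eq]; exact N.rel_cont R i ε hε a b h) hε
    choose δ hδ h using fun i => (u i).exists_modulus (N := N) η hη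
    obtain ⟨δ', hδ', hle⟩ := exists_pos_forall_le δ hδ
    exact ⟨δ', hδ', fun v v' hv =>
      (hR _ _ fun i => h i v v' fun j => (hv j).trans_le (hle i)).le⟩
  | conn n f hf φ ih =>
    intro ε hε
    obtain ⟨η, hη, hfη⟩ := Metric.uniformContinuous_iff.1 hf ε hε
    choose δ hδ h using fun i => ih i (η / 2) (half_pos hη)
    obtain ⟨δ', hδ', hle⟩ := exists_pos_forall_le δ hδ
    refine ⟨δ', hδ', fun v v' hv => (hfη ?_).le⟩
    refine lt_of_le_of_lt ((dist_pi_le_iff (half_pos hη).le).2 fun i => ?_) (half_lt_self hη)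
    exact h i v v' fun j => (hv j).trans_le (hle i)
  | @inf α s S φ ih =>
    intro ε hε
    obtain ⟨δ, hδ, H⟩ := ih ε hε
    have key (v v' : Tuple N s) (h : ∀ i, Dist.dist (v i) (v' i) < δ) :
        (Formula.inf S φ).eval v - ε ≤ (Formula.inf S φ).eval v' := by
      refine le_ciInf fun x => ?_
      have h1 := ciInf_le (bdd _ _ _ φ v).1 x
      have h2 := abs_le.1 (H _ _ (cons_lt hδ h x))
      simp only [Formula.eval]
      linarith
    refine ⟨δ, hδ, fun v v' h => abs_le.2 ⟨?_, ?_⟩⟩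
    · linarith [key v' v fun i => by rw [dist_comm]; exact h i]
    · linarith [key v v' h]
  | @sup α s S φ ih =>
    intro ε hε
    obtain ⟨δ, hδ, H⟩ := ih ε hε
    have key (v v' : Tuple N s) (h : ∀ i, Dist.dist (v i) (v' i) < δ) :
        (Formula.sup S φ).eval v ≤ (Formula.sup S φ).eval v' + ε := by
      refine ciSup_le fun x => ?_
      have h1 := le_ciSup (bdd _ _ _ φ v').2 x
      have h2 := abs_le.1 (H _ _ (cons_lt hδ h x))
      simp only [Formula.eval]
      linarith
    refine ⟨δ, hδ, fun v v' h => abs_le.2 ⟨?_, ?_⟩⟩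
    · linarith [key v' v fun i => by rw [dist_comm]; exact h i]
    · linarith [key v v' h]

theorem IsPredicate.exists_modulus {A : Params N} {α : Type w} {s : α → L.Sorts}
    {P : Tuple N s → ℝ} (hP : IsPredicate A P) {ε : ℝ} (hε : 0 < ε) :
    ∃ δ > 0, ∀ v v' : Tuple N s, (∀ i, dist (v i) (v' i) < δ) → |P v - P v'| ≤ ε := by
  obtain ⟨φ, hφ⟩ := hP (ε / 3) (by positivity)
  obtain ⟨δ, hδ, H⟩ := Formula.exists_modulus (N := N) φ (ε / 3) (by positivity)
  refine ⟨δ, hδ, fun v v' h => ?_⟩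
  have h0 : |φ.val v - φ.val v'| ≤ ε / 3 := by
    refine H _ _ fun i => ?_
    cases i with
    | inl i => exact h i
    | inr c => exact (dist_self _).trans_lt hδ
  have h1 := abs_le.1 (hφ v)
  have h2 := abs_le.1 (hφ v')
  have h3 := abs_le.1 h0
  exact abs_le.2 ⟨by linarith, by linarith⟩

theorem IsPredicate.mul {A : Params N} {α : Type w} {s : α → L.Sorts} {P Q : Tuple N s → ℝ}
    (hP : IsPredicate A P) (hQ : IsPredicate A Q) : IsPredicate A fun v => P v * Q v := by
  obtain ⟨B, hB⟩ := hP.exists_bound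
  obtain ⟨C, hC⟩ := hQ.exists_bound
  intro ε hε
  -- Multiplication is not uniformly continuous on the plane, but it is on bounded sets, so it is
  -- composed with a retraction onto an interval containing all the values.
  have hne : -(max B C ⊔ 0) ≤ max B C ⊔ 0 := by linarith [le_max_right (max B C) 0]
  set D := max B C ⊔ 0 with hD
  have hmul : UniformContinuous fun z : Set.Icc (-D) D × Set.Icc (-D) D => (z.1 : ℝ) * z.2 :=
    CompactSpace.uniformContinuous_of_continuous (by fun_prop)
  have hproj : UniformContinuous (Set.projIcc (-D) D hne) :=
    (LipschitzWith.projIcc hne).uniformContinuous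
  have hf : UniformContinuous fun z : Fin 2 → ℝ =>
      (Set.projIcc (-D) D hne (z 0) : ℝ) * Set.projIcc (-D) D hne (z 1) :=
    hmul.comp ((hproj.comp (Pi.uniformContinuous_proj _ 0)).prodMk
      (hproj.comp (Pi.uniformContinuous_proj _ 1)))
  have h := IsPredicate.conn (A := A) hf (P := ![P, Q]) (by intro i; fin_cases i <;> assumption)
  have hval (r : ℝ) (hr : |r| ≤ D) : (Set.projIcc (-D) D hne r : ℝ) = r := by
    rw [Set.projIcc_of_mem hne (abs_le.1 hr)]
  have heq : (fun v => P v * Q v) = fun v => (Set.projIcc (-D) D hne (![P, Q] 0 v) : ℝ) *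
      Set.projIcc (-D) D hne (![P, Q] 1 v) := by
    funext v
    rw [hval, hval]
    · rfl
    · exact (hC v).trans (le_sup_of_le_left (le_max_right B C))
    · exact (hB v).trans (le_sup_of_le_left (le_max_left B C))
  rw [heq]
  exact h ε hε

end Continuity

/-! ### Quantification over finite tuples and over the group -/

section Quantification

variable {N : Struc.{uS, uF, uR, uN} L}

/-- The infimum of a formula over a finite block of variables is the value of a formula. -/
theorem Formula.exists_inf_block (n : ℕ) : ∀ (s : Fin n → L.Sorts) {γ : Type w} {t : γ → L.Sorts}
    (φ : Formula L (Fin n ⊕ γ) (Sum.elim s t)), ∃ χ : Formula L γ t, ∀ (y : Tuple N t) (r : ℝ),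
      r ≤ χ.eval y ↔ ∀ x : Tuple N s, r ≤ φ.eval (Tuple.append x y) := by
  induction n with
  | zero =>
    intro s γ t φ
    let σ : ∀ i : Fin 0 ⊕ γ, Term L t (Sum.elim s t i) := fun i => match i with
      | .inr j => .var j
    have hσ (x : Tuple N s) (y : Tuple N t) :
        (fun i => (σ i).eval y) = Tuple.append x y := by
      funext i
      rcases i with i | j
      · exact i.elim0
      · rfl
    refine ⟨φ.subst σ, fun y r => ?_⟩
    rw [Formula.eval_subst]
    exact ⟨fun h x => by rwa [hσ x y] at h, fun h => by
      rw [hσ (fun i => i.elim0) y]; exact h _⟩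
  | succ n ih =>
    intro s γ t φ
    let σ : ∀ i : Fin (n + 1) ⊕ γ,
        Term L (consSort (s 0) (Sum.elim (fun i => s (Fin.succ i)) t)) (Sum.elim s t i) :=
      fun i => match i with
      | .inl i => Fin.cases (motive := fun i =>
            Term L (consSort (s 0) (Sum.elim (fun i => s (Fin.succ i)) t)) (s i))
          (.var (s := consSort (s 0) (Sum.elim (fun i => s (Fin.succ i)) t)) none)
          (fun i => .var (s := consSort (s 0) (Sum.elim (fun i => s (Fin.succ i)) t))
            (some (.inl i))) i
      | .inr j => .var (s := consSort (s 0) (Sum.elim (fun i => s (Fin.succ i)) t))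
          (some (.inr j))
    have hσ (x : Tuple N s) (y : Tuple N t) :
        (fun i => (σ i).eval (Tuple.cons (x 0) (Tuple.append (fun i : Fin n => x i.succ) y))) =
          Tuple.append x y := by
      funext i
      rcases i with i | j
      · induction i using Fin.cases <;> rfl
      · rfl
    obtain ⟨χ, hχ⟩ := ih (fun i => s i.succ) (Formula.inf (s 0) (φ.subst σ))
    refine ⟨χ, fun y r => ?_⟩
    rw [hχ]
    obtain ⟨B, hB⟩ := (φ.subst σ).exists_bound (N := N)
    have hinf (v : Tuple N (Sum.elim (fun i : Fin n => s i.succ) t)) :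
        r ≤ (Formula.inf (s 0) (φ.subst σ)).eval v ↔
          ∀ x, r ≤ (φ.subst σ).eval (Tuple.cons x v) :=
      le_ciInf_iff ⟨-B, by rintro _ ⟨x, rfl⟩; exact (abs_le.1 (hB _)).1⟩
    simp only [hinf, Formula.eval_subst]
    constructor
    · intro h x
      rw [← hσ]
      exact h _ (x 0)
    · intro h x x₀
      have := h (Fin.cons x₀ x)
      rw [← hσ] at this
      exact this

/-- Whether a predicate is bounded below by `r` along a finite tuple of variables depends only on
the type of the remaining variables. -/
theorem TypeEq.forall_le_of_forall_le {A : Params N} {n : ℕ} {s : Fin n → L.Sorts} {β : Type w}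
    {t : β → L.Sorts} {P : Tuple N (Sum.elim s t) → ℝ} (hP : IsPredicate A P) {a a' : Tuple N t}
    (ha : TypeEq A a a') {r : ℝ} (h : ∀ x : Tuple N s, r ≤ P (Tuple.append x a))
    (x : Tuple N s) : r ≤ P (Tuple.append x a') := by
  refine le_of_forall_pos_le_add fun ε hε => ?_
  obtain ⟨φ, hφ⟩ := hP (ε / 2) (half_pos hε)
  let σ : ∀ i : (Fin n ⊕ β) ⊕ Names A,
      Term L (Sum.elim s (Sum.elim t (Sigma.fst : Names A → L.Sorts)))
        (Sum.elim (Sum.elim s t) (Sigma.fst : Names A → L.Sorts) i) := fun i => match i with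
    | .inl (.inl i) => .var (s := Sum.elim s (Sum.elim t (Sigma.fst : Names A → L.Sorts)))
        (.inl i)
    | .inl (.inr j) => .var (s := Sum.elim s (Sum.elim t (Sigma.fst : Names A → L.Sorts)))
        (.inr (.inl j))
    | .inr c => .var (s := Sum.elim s (Sum.elim t (Sigma.fst : Names A → L.Sorts)))
        (.inr (.inr c))
  obtain ⟨χ, hχ⟩ := Formula.exists_inf_block (N := N) n s (Formula.subst φ σ)
  have hval (x : Tuple N s) (y : Tuple N t) : (Formula.subst φ σ).eval (N := N)
      (Tuple.append x (Tuple.append y (t := (Sigma.fst : Names A → L.Sorts))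
        fun c => (c.2 : N.carrier c.1))) = φ.val (Tuple.append x y) := by
    refine (Formula.eval_subst _ _ _).trans ?_
    unfold FormulaOver.val
    congr 1
    funext i
    rcases i with (i | j) | c <;> rfl
  have h1 : r - ε / 2 ≤ FormulaOver.val χ a := (hχ _ _).2 fun x => by
    rw [hval]
    linarith [h x, (abs_le.1 (hφ (Tuple.append x a))).1]
  have h2 := (hχ _ _).1 (h1.trans_eq (ha χ)) x
  rw [hval] at h2
  linarith [(abs_le.1 (hφ (Tuple.append x a'))).2]

variable {A : Params N}

/-- Positivity of `P (x, a)` on a definable group depends only on the type of `a`.  If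
`P (x, a) ≥ 0` on `G`, then by uniform continuity `P (x, a) + K * d (x, G) ≥ -ε` for all tuples `x`
and large `K`, a condition on the type of `a`, which on `G` reads `P (x, a) ≥ -ε`. -/
theorem DefGroup.inst_nonneg_of_typeEq (G : DefGroup N A) {β : Type} {t : β → L.Sorts}
    {P : Tuple N (Sum.elim G.sorts t) → ℝ} (hP : IsPredicate A P) {a a' : Tuple N t}
    (ha : TypeEq A a a') (h : ∀ x, 0 ≤ G.inst P a x) (x : G.carrier) : 0 ≤ G.inst P a' x := by
  refine le_of_forall_pos_le_add fun ε hε => ?_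
  obtain ⟨δ, hδ, hmod⟩ := hP.exists_modulus hε
  obtain ⟨B, hB⟩ := hP.exists_bound
  have hB0 : 0 ≤ B := (abs_nonneg _).trans (hB (Tuple.append (x : Tuple N G.sorts) a))
  have hd : IsPredicate A fun v : Tuple N (Sum.elim G.sorts t) =>
      Metric.infDist (fun i => v (.inl i) : Tuple N G.sorts) G.carrier :=
    G.definable.subst (fun _ => subset_rfl) (t := Sum.elim G.sorts t) fun i =>
      .var (s := Sum.elim (Sum.elim G.sorts t) (Sigma.fst : Names A → L.Sorts)) (.inl (.inl i))
  have hR : IsPredicate A fun v : Tuple N (Sum.elim G.sorts t) =>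
      P v + B / δ * Metric.infDist (fun i => v (.inl i) : Tuple N G.sorts) G.carrier :=
    hP.add (hd.comp (uniformContinuous_const_smul (B / δ)))
  have hne : G.carrier.Nonempty := ⟨x, x.2⟩
  have key := ha.forall_le_of_forall_le hR (r := -ε) (fun y => by
    change -ε ≤ P (Tuple.append y a) + B / δ * Metric.infDist y G.carrier
    by_cases hy : Metric.infDist y G.carrier < δ
    · obtain ⟨g, hg, hyg⟩ := (Metric.infDist_lt_iff hne).1 hy
      have h1 := abs_le.1 (hmod (Tuple.append y a) (Tuple.append g a) (by
        rintro (i | j)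
        · exact (dist_le_pi_dist y g i).trans_lt hyg
        · exact (dist_self _).trans_lt hδ))
      have h2 : 0 ≤ P (Tuple.append g a) := h ⟨g, hg⟩
      have h3 : 0 ≤ B / δ * Metric.infDist y G.carrier :=
        mul_nonneg (by positivity) Metric.infDist_nonneg
      linarith
    · have h1 : B / δ * δ ≤ B / δ * Metric.infDist y G.carrier :=
        mul_le_mul_of_nonneg_left (not_lt.1 hy) (by positivity)
      rw [div_mul_cancel₀ _ hδ.ne'] at h1
      linarith [(abs_le.1 (hB (Tuple.append y a))).1]) x
  change -ε ≤ P (Tuple.append x a') + B / δ * Metric.infDist (x : Tuple N G.sorts) G.carrier at key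
  rw [Metric.infDist_zero_of_mem x.2, mul_zero, add_zero] at key
  change 0 ≤ P (Tuple.append x a') + ε
  linarith

end Quantification

/-! ### The truncation -/

section Trunc

theorem trunc_of_nonneg {t : ℝ} (ht : 0 ≤ t) : trunc t = min t 1 := by
  unfold trunc
  rcases le_total t 1 with h | h
  · rw [max_eq_left (by linarith : (0 : ℝ) ≤ 1 - t), min_eq_left h, max_eq_left] <;> linarith
  · rw [max_eq_right (by linarith : 1 - t ≤ 0), min_eq_right h, max_eq_left] <;> linarith

theorem trunc_mono : Monotone trunc := fun s t h => by
  unfold trunc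
  gcongr

theorem trunc_nonneg (t : ℝ) : 0 ≤ trunc t := le_max_right _ _

theorem trunc_le_one (t : ℝ) : trunc t ≤ 1 :=
  max_le (by linarith [le_max_right (1 - t) 0]) zero_le_one

/-- The lower bound `a * b ≥ a + b - 1` for `a`, `b` in the unit interval, applied to the
truncations of `a` and `b`. -/
theorem trunc_add_trunc_le {a b : ℝ} (ha : 0 ≤ a) (hb : 0 ≤ b) :
    trunc a + trunc b ≤ trunc (a * b) + 1 := by
  rw [trunc_of_nonneg ha, trunc_of_nonneg hb, trunc_of_nonneg (mul_nonneg ha hb)]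
  rcases le_total a 1 with h | h <;> rcases le_total b 1 with h' | h' <;>
    rcases le_total (a * b) 1 with h'' | h'' <;>
    simp only [min_eq_left, min_eq_right, h, h', h''] <;> nlinarith

theorem trunc_half_add_le {a b : ℝ} : trunc ((a + b) / 2) ≤ max (trunc a) (trunc b) := by
  rw [← trunc_mono.map_max]
  exact trunc_mono (by linarith [le_max_left a b, le_max_right a b])

/-- A Bonferroni-type inequality for functions with values in `[0, 1]`. -/
theorem sum_le_one_add_sum_min (q : ℕ → ℝ) (h0 : ∀ i, 0 ≤ q i) (h1 : ∀ i, q i ≤ 1) (n : ℕ) :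
    ∑ i ∈ Finset.range n, q i ≤
      1 + ∑ j ∈ Finset.range n, ∑ i ∈ Finset.range j, min (q i) (q j) := by
  have hmin (i j : ℕ) : 0 ≤ min (q i) (q j) := le_min (h0 i) (h0 j)
  induction n with
  | zero => simp
  | succ n ih =>
    rw [Finset.sum_range_succ, Finset.sum_range_succ]
    -- Either `q n` is at most some earlier `q i`, and is paid for by `min (q i) (q n)`, or it
    -- exceeds all earlier ones, which are then all paid for, while `q n ≤ 1`.
    by_cases hex : ∃ i < n, q n ≤ q i
    · obtain ⟨i, hi, hle⟩ := hex
      have h2 := Finset.single_le_sum (fun i _ => hmin i n) (Finset.mem_range.2 hi)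
      rw [min_eq_right hle] at h2
      linarith
    · push Not at hex
      have h2 : ∑ i ∈ Finset.range n, min (q i) (q n) = ∑ i ∈ Finset.range n, q i :=
        Finset.sum_congr rfl fun i hi => min_eq_left (hex i (Finset.mem_range.1 hi)).le
      have h3 : 0 ≤ ∑ j ∈ Finset.range n, ∑ i ∈ Finset.range j, min (q i) (q j) :=
        Finset.sum_nonneg fun j _ => Finset.sum_nonneg fun i _ => hmin i j
      linarith [h1 n]

end Trunc

/-! ### Means and small predicates -/

section Mean

variable {N : Struc.{uS, uF, uR, uN} L} {A : Params N} {G : DefGroup N A} {m : G.Pred →ₗ[ℝ] ℝ}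

theorem DefGroup.inst_mem_pred (G : DefGroup N A) {β : Type} {t : β → L.Sorts}
    {P : Tuple N (Sum.elim G.sorts t) → ℝ} (hP : IsPredicate A P) (a : Tuple N t) :
    G.inst P a ∈ G.Pred := by
  let σ : ∀ i : Fin G.n ⊕ β, Term L
      (Sum.elim G.sorts (Sigma.fst : Names (N := N) (fun _ => Set.univ) → L.Sorts))
      (Sum.elim G.sorts t i) := fun i => match i with
    | .inl i => .var
        (s := Sum.elim G.sorts (Sigma.fst : Names (N := N) (fun _ => Set.univ) → L.Sorts)) (.inl i)
    | .inr j => .var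
        (s := Sum.elim G.sorts (Sigma.fst : Names (N := N) (fun _ => Set.univ) → L.Sorts))
        (.inr ⟨t j, a j, trivial⟩)
  refine ⟨_, hP.subst (B := fun _ => Set.univ) (fun _ => Set.subset_univ _) (t := G.sorts) σ,
    fun x => ?_⟩
  unfold DefGroup.inst
  congr 1
  funext i
  cases i <;> rfl

theorem DefGroup.mul_mem_pred {p q : G.carrier → ℝ} (hp : p ∈ G.Pred) (hq : q ∈ G.Pred) :
    p * q ∈ G.Pred := by
  obtain ⟨P, hP, hp⟩ := hp
  obtain ⟨Q, hQ, hq⟩ := hq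
  exact ⟨_, hP.mul hQ, fun x => by simp [hp, hq]⟩

theorem DefGroup.min_mem_pred {p q : G.carrier → ℝ} (hp : p ∈ G.Pred) (hq : q ∈ G.Pred) :
    (fun x => min (p x) (q x)) ∈ G.Pred := by
  obtain ⟨P, hP, hp⟩ := hp
  obtain ⟨Q, hQ, hq⟩ := hq
  have h := IsPredicate.conn (A := fun _ => Set.univ) (n := 2)
    (f := fun x : Fin 2 → ℝ => min (x 0) (x 1))
    (LipschitzWith.uniformContinuous
      ((LipschitzWith.eval (0 : Fin 2)).min (LipschitzWith.eval (1 : Fin 2)))) (P := ![P, Q])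
    (by intro i; fin_cases i <;> assumption)
  exact ⟨_, h, fun x => by simp [hp, hq]⟩

theorem IsMean.mono (hm : IsMean G m) {p q : G.Pred} (h : ∀ x, p.1 x ≤ q.1 x) : m p ≤ m q := by
  have := hm.nonneg (q - p) fun x => sub_nonneg.2 (h x)
  rw [map_sub] at this
  linarith

theorem IsMean.bar_le_one (hm : IsMean G m) (p : G.Pred) : m (G.bar p) ≤ 1 :=
  (hm.mono (q := G.constPred 1) fun _ => trunc_le_one _).trans_eq hm.one

/-- A positive predicate is small when the truncations of its multiples have means arbitrarily
close to `1`: these means increase and are at most `1`. -/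
theorem IsMean.tendsto_bar_iff (hm : IsMean G m) {p : G.Pred} (hp : ∀ x, 0 ≤ p.1 x) :
    Tendsto (fun r : ℝ => m (G.bar (r • p))) atTop (𝓝 1) ↔
      ∀ ε > 0, ∃ r : ℝ, 0 ≤ r ∧ 1 - ε < m (G.bar (r • p)) := by
  constructor
  · intro h ε hε
    obtain ⟨r, h1, h2⟩ := ((h.eventually_const_lt (by linarith : 1 - ε < 1)).and
      (eventually_ge_atTop 0)).exists
    exact ⟨r, h2, h1⟩
  · intro h
    refine tendsto_order.2 ⟨fun c hc => ?_, fun c hc => .of_forall fun r =>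
      (hm.bar_le_one _).trans_lt hc⟩
    obtain ⟨r, -, hr⟩ := h (1 - c) (by linarith)
    filter_upwards [eventually_ge_atTop r] with r' hr'
    refine (by linarith : c < m (G.bar (r • p))).trans_le (hm.mono fun x => trunc_mono ?_)
    exact mul_le_mul_of_nonneg_right hr' (hp x)

theorem isIdeal_small (hm : IsMean G m) : IsIdeal G (small G m) where
  subset := fun p ⟨h, hp, _⟩ => ⟨hp, h⟩
  upward := by
    rintro p ⟨hp0, hp, hlim⟩ q ⟨hq, hq0⟩ hpq
    refine ⟨hq0, hq, (hm.tendsto_bar_iff hq0).2 fun ε hε => ?_⟩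
    obtain ⟨r, hr, h⟩ := (hm.tendsto_bar_iff hp0).1 hlim ε hε
    exact ⟨r, hr, h.trans_le <| hm.mono fun x =>
      trunc_mono (mul_le_mul_of_nonneg_left (hpq x) hr)⟩
  mul := by
    rintro p ⟨hp0, hp, hp1⟩ q ⟨hq0, hq, hq1⟩
    have hpq : ∀ x, 0 ≤ (p * q) x := fun x => mul_nonneg (hp0 x) (hq0 x)
    refine ⟨hpq, DefGroup.mul_mem_pred hp hq, (hm.tendsto_bar_iff hpq).2 fun ε hε => ?_⟩
    obtain ⟨r, hr, h⟩ := (hm.tendsto_bar_iff hp0).1 hp1 (ε / 2) (half_pos hε)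
    obtain ⟨s, hs, h'⟩ := (hm.tendsto_bar_iff hq0).1 hq1 (ε / 2) (half_pos hε)
    refine ⟨r * s, mul_nonneg hr hs, ?_⟩
    have key := hm.mono (p := G.bar (r • ⟨p, hp⟩) + G.bar (s • ⟨q, hq⟩))
      (q := G.bar ((r * s) • ⟨p * q, DefGroup.mul_mem_pred hp hq⟩) + G.constPred 1) fun x => by
        change trunc (r * p x) + trunc (s * q x) ≤ trunc (r * s * (p x * q x)) + 1
        rw [mul_mul_mul_comm]
        exact trunc_add_trunc_le (mul_nonneg hr (hp0 x)) (mul_nonneg hs (hq0 x))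
    rw [map_add, map_add, hm.one] at key
    linarith
  const := by
    intro r hr
    refine ⟨fun _ => hr.le, (G.constPred r).2, (hm.tendsto_bar_iff fun _ => hr.le).2
      fun ε hε => ⟨r⁻¹, by positivity, ?_⟩⟩
    have h : G.constPred 1 = G.bar (r⁻¹ • G.constPred r) := by
      refine Subtype.ext (funext fun x => ?_)
      change 1 = trunc (r⁻¹ * r)
      rw [inv_mul_cancel₀ hr.ne']
      simp [trunc]
    have h1 := hm.one
    rw [h] at h1
    change 1 - ε < m (G.bar (r⁻¹ • G.constPred r))
    linarith

theorem IsInvariantMean.bar_eq (hM : IsInvariantMean G m) {β : Type} {t : β → L.Sorts}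
    {P : Tuple N (Sum.elim G.sorts t) → ℝ} (hP : IsPredicate A P) {a a' : Tuple N t}
    (ha : TypeEq A a a') (r : ℝ) {p p' : G.Pred} (hp : p.1 = G.inst P a)
    (hp' : p'.1 = G.inst P a') : m (G.bar (r • p)) = m (G.bar (r • p')) := by
  refine hM β t (fun v => trunc (r * P v))
    ((hP.comp (uniformContinuous_const_smul r)).comp uniformContinuous_trunc) a a' ha _ _ ?_ ?_
  · funext x
    change trunc (r * p.1 x) = trunc (r * G.inst P a x)
    rw [hp]
  · funext x
    change trunc (r * p'.1 x) = trunc (r * G.inst P a' x)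
    rw [hp']

theorem isInvariantSet_small (hM : IsInvariantMean G m) : IsInvariantSet G (small G m) := by
  rintro β t P hP a a' ha ⟨h0, h, hlim⟩
  refine ⟨G.inst_nonneg_of_typeEq hP ha h0, G.inst_mem_pred hP a', ?_⟩
  exact hlim.congr fun r => hM.bar_eq hP ha r rfl rfl

/-- If the predicates `p i` were equally far from being small, the predicates
`q i = 1 - bar (r • p i)` would have means at least `ε`, uniformly in `r` and `i`, while the mean
of `min (q i) (q j)` tends to `0` with `r → ∞` for `i ≠ j`.  For `n * ε > 2` this contradicts
`∑ i < n, q i ≤ 1 + ∑ i < j < n, min (q i) (q j)`. -/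
theorem isS1_small (hm : IsMean G m) (hM : IsInvariantMean G m) : IsS1 G (small G m) := by
  rintro p ⟨β, t, P, a, hP, ha, hpa⟩ hpos hsum i₀
  let p' (i : ℕ) : G.Pred := ⟨p i, (hpos i).1⟩
  refine ⟨(hpos i₀).2, (hpos i₀).1, (hm.tendsto_bar_iff (p := p' i₀) (hpos i₀).2).2 ?_⟩
  by_contra! hcon
  obtain ⟨ε, hε, hcon⟩ := hcon
  let q (r : ℝ) (i : ℕ) : G.Pred := G.constPred 1 - G.bar (r • p' i)
  have hq (r : ℝ) (hr : 0 ≤ r) (i : ℕ) : ε ≤ m (q r i) := by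
    have h1 : m (q r i) = 1 - m (G.bar (r • p' i)) := by rw [map_sub, hm.one]
    rw [h1, hM.bar_eq hP (ha.typeEq i i₀) r (p' := p' i₀) (hpa i) (hpa i₀)]
    linarith [hcon r hr]
  let μ (r : ℝ) (i j : ℕ) : G.Pred :=
    ⟨fun x => min ((q r i).1 x) ((q r j).1 x), DefGroup.min_mem_pred (q r i).2 (q r j).2⟩
  have hμ (i j : ℕ) (hij : i ≠ j) (η : ℝ) (hη : 0 < η) : ∀ᶠ r in atTop, m (μ r i j) < η := by
    obtain ⟨-, hmem, hlim⟩ := hsum i j hij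
    have hlim' := hlim.comp (tendsto_id.atTop_div_const (two_pos : (0 : ℝ) < 2))
    filter_upwards [hlim'.eventually_const_lt (by linarith : 1 - η < 1)] with r hr
    have key := hm.mono (p := μ r i j)
      (q := G.constPred 1 - G.bar ((r / 2) • ⟨p i + p j, hmem⟩)) fun x => by
        change min (1 - trunc (r * p i x)) (1 - trunc (r * p j x)) ≤
          1 - trunc (r / 2 * (p i x + p j x))
        have h := trunc_half_add_le (a := r * p i x) (b := r * p j x)
        rw [show (r * p i x + r * p j x) / 2 = r / 2 * (p i x + p j x) by ring] at h
        rcases le_max_iff.1 h with h | h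
        · exact (min_le_left _ _).trans (by linarith)
        · exact (min_le_right _ _).trans (by linarith)
    rw [map_sub, hm.one] at key
    simp only [Function.comp_apply, id_eq] at hr
    linarith
  obtain ⟨n, hn⟩ := exists_nat_gt (2 / ε)
  rw [div_lt_iff₀ hε] at hn
  have hη : (0 : ℝ) < 1 / (n * n + 1) := by positivity
  have hev : ∀ᶠ r in atTop, ∀ j ∈ Finset.range n, ∀ i ∈ Finset.range j,
      m (μ r i j) < 1 / (n * n + 1) :=
    (Filter.eventually_all_finset _).2 fun j _ => (Filter.eventually_all_finset _).2 fun i hi =>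
      hμ i j (Finset.mem_range.1 hi).ne _ hη
  obtain ⟨r, hr, hr0⟩ := (hev.and (eventually_ge_atTop 0)).exists
  have key := hm.mono (p := ∑ i ∈ Finset.range n, q r i)
    (q := G.constPred 1 + ∑ j ∈ Finset.range n, ∑ i ∈ Finset.range j, μ r i j) fun x => by
      have h := sum_le_one_add_sum_min (fun i => (q r i).1 x)
        (fun i => sub_nonneg.2 (trunc_le_one _)) (fun i => sub_le_self _ (trunc_nonneg _)) n
      simpa [Submodule.coe_sum, Finset.sum_apply, DefGroup.constPred, μ] using h
  simp only [map_add, map_sum, hm.one] at key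
  have hlow : n * ε ≤ ∑ i ∈ Finset.range n, m (q r i) := by
    simpa using Finset.card_nsmul_le_sum (Finset.range n) _ ε fun i _ => hq r hr0 i
  have hup : ∑ j ∈ Finset.range n, ∑ i ∈ Finset.range j, m (μ r i j) ≤ 1 := by
    calc _ ≤ ∑ j ∈ Finset.range n, ∑ i ∈ Finset.range j, (1 / (n * n + 1) : ℝ) :=
          Finset.sum_le_sum fun j hj => Finset.sum_le_sum fun i hi => (hr j hj i hi).le
      _ ≤ ∑ j ∈ Finset.range n, n * (1 / (n * n + 1) : ℝ) := by
          refine Finset.sum_le_sum fun j hj => ?_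
          rw [Finset.sum_const, Finset.card_range, nsmul_eq_mul]
          have : (j : ℝ) ≤ n := by exact_mod_cast (Finset.mem_range.1 hj).le
          gcongr
      _ = n * n / (n * n + 1) := by
          rw [Finset.sum_const, Finset.card_range, nsmul_eq_mul]; ring
      _ ≤ 1 := by rw [div_le_one (by positivity)]; linarith
  linarith

end Mean

end ContLogic

theorem mainTheorem4 {L : ContLogic.Language} {N : ContLogic.Struc L} {M : ContLogic.Params N}
    (G : ContLogic.DefGroup N M) (m : G.Pred →ₗ[ℝ] ℝ)
    (hm : ContLogic.IsMean G m) (hG : ContLogic.IsGInvariant G m)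
    (hM : ContLogic.IsInvariantMean G m) :
    ContLogic.IsIdeal G (ContLogic.small G m) ∧
      ContLogic.IsInvariantSet G (ContLogic.small G m) ∧
      ContLogic.IsS1 G (ContLogic.small G m) :=
  ⟨ContLogic.isIdeal_small hm, ContLogic.isInvariantSet_small hM, ContLogic.isS1_small hm hM⟩
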